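/- A \emph{horizontal tribracket} is a set $X$ with a ternary operation $[\,,\,,\,]$ such that (i) for all $x,y,z\in X$ there are unique $u,v,w\in X$ with $[x,y,u]=z$, $[x,v,y]=z$ and $[w,x,y]=z$, and (ii) for all $x,y,z,w\in X$, \[[y,[x,y,z],[x,y,w]]=[z,[x,y,z],[x,z,w]]=[w,[x,y,w],[x,z,w]].\] It is \emph{late-commutative} if $[x,y,z]=[x,z,y]$ for all $x,y,z\in X$. For an oriented link diagram $D$, the \emph{fundamental tribracket} $\mathcal T(D)$ is the horizontal tribracket presented by one generator for each region of the complement of $D$ and, for each crossing, one relation $[x,y,z]=w$, where $x$ is the region to the left of both strands, $y$ is the region reached from $x$ across the over strand, $z$ the region reached from $x$ across the under strand, and $w$ is the region to the right of both strands. For a finite horizontal tribracket $X$, the \emph{counting invariant} of the oriented link $L$ with diagram $D$ is $\Phi_X^{\mathbb Z}(L)=|\mathrm{Hom}(\mathcal T(D),X)|$, the number of tribracket homomorphisms. \textbf{Proposition.} Let $X$ be a finite late-commutative horizontal tribracket, let $L$ be an oriented link with $c$ components, and let $D$ be any diagram of $L$. Then \[\Phi_X^{\mathbb Z}(L)=|\mathrm{Hom}(\mathcal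 T(D),X)|=|X|^{c+1}.\] -/

import Mathlib

/-! ## Horizontal tribrackets -/

/-- A horizontal tribracket: a set with a ternary operation `br x y z = [x,y,z]` that is uniquely
invertible in each of its three places and satisfies the exchange identities. -/
class HorizontalTribracket (X : Type*) where
  br : X → X → X → X
  existsUnique_right : ∀ x y z : X, ∃! u, br x y u = z
  existsUnique_center : ∀ x y z : X, ∃! v, br x v y = z
  existsUnique_left : ∀ x y z : X, ∃! w, br w x y = z
  exchange_left : ∀ x y z w : X,
    br y (br x y z) (br x y w) = br z (br x y z) (br x z w)
  exchange_right : ∀ x y z w : X,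
    br z (br x y z) (br x z w) = br w (br x y w) (br x z w)

namespace HorizontalTribracket

/-- `[x,y,z] = [x,z,y]` for all `x, y, z`. -/
def LateCommutative (X : Type*) [HorizontalTribracket X] : Prop :=
  ∀ x y z : X, br x y z = br x z y

/-- Homomorphisms of horizontal tribrackets. -/
structure Hom (X Y : Type*) [HorizontalTribracket X] [HorizontalTribracket Y] where
  toFun : X → Y
  map_br : ∀ x y z : X, toFun (br x y z) = br (toFun x) (toFun y) (toFun z)

/-! ## Tribrackets given by generators and relations -/

/-- Tribracket words on a set `G` of generators. The last three constructors are the formal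
left, center and right inverses `[x̄,y,z]`, `[x,ȳ,z]` and `[x,y,z̄]`. -/
inductive Word (G : Type*) where
  | gen : G → Word G
  | br : Word G → Word G → Word G → Word G
  | linv : Word G → Word G → Word G → Word G
  | cinv : Word G → Word G → Word G → Word G
  | rinv : Word G → Word G → Word G → Word G

/-- The smallest congruence on words that contains the relations `rel` and makes the quotient a
horizontal tribracket. -/
inductive Word.Equiv {G : Type*} (rel : Word G → Word G → Prop) : Word G → Word G → Prop
  | of (x y : Word G) : rel x y → Word.Equiv rel x y
  | refl (x : Word G) : Word.Equiv rel x x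
  | symm (x y : Word G) : Word.Equiv rel x y → Word.Equiv rel y x
  | trans (x y z : Word G) : Word.Equiv rel x y → Word.Equiv rel y z → Word.Equiv rel x z
  | br_congr (x₁ x₂ y₁ y₂ z₁ z₂ : Word G) : Word.Equiv rel x₁ x₂ → Word.Equiv rel y₁ y₂ →
      Word.Equiv rel z₁ z₂ → Word.Equiv rel (.br x₁ y₁ z₁) (.br x₂ y₂ z₂)
  | linv_congr (x₁ x₂ y₁ y₂ z₁ z₂ : Word G) : Word.Equiv rel x₁ x₂ → Word.Equiv rel y₁ y₂ →
      Word.Equiv rel z₁ z₂ → Word.Equiv rel (.linv x₁ y₁ z₁) (.linv x₂ y₂ z₂)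
  | cinv_congr (x₁ x₂ y₁ y₂ z₁ z₂ : Word G) : Word.Equiv rel x₁ x₂ → Word.Equiv rel y₁ y₂ →
      Word.Equiv rel z₁ z₂ → Word.Equiv rel (.cinv x₁ y₁ z₁) (.cinv x₂ y₂ z₂)
  | rinv_congr (x₁ x₂ y₁ y₂ z₁ z₂ : Word G) : Word.Equiv rel x₁ x₂ → Word.Equiv rel y₁ y₂ →
      Word.Equiv rel z₁ z₂ → Word.Equiv rel (.rinv x₁ y₁ z₁) (.rinv x₂ y₂ z₂)
  | br_linv (x y z : Word G) : Word.Equiv rel (.br (.linv x y z) y z) x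
  | linv_br (x y z : Word G) : Word.Equiv rel (.linv (.br x y z) y z) x
  | br_cinv (x y z : Word G) : Word.Equiv rel (.br x (.cinv x y z) z) y
  | cinv_br (x y z : Word G) : Word.Equiv rel (.cinv x (.br x y z) z) y
  | br_rinv (x y z : Word G) : Word.Equiv rel (.br x y (.rinv x y z)) z
  | rinv_br (x y z : Word G) : Word.Equiv rel (.rinv x y (.br x y z)) z
  | exchange_left (x y z w : Word G) :
      Word.Equiv rel (.br y (.br x y z) (.br x y w)) (.br z (.br x y z) (.br x z w))
  | exchange_right (x y z w : Word G) :
      Word.Equiv rel (.br z (.br x y z) (.br x z w)) (.br w (.br x y w) (.br x z w))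

/-- `Word.Equiv rel` as a setoid. -/
def Word.setoid {G : Type*} (rel : Word G → Word G → Prop) : Setoid (Word G) where
  r := Word.Equiv rel
  iseqv := ⟨Word.Equiv.refl, fun h => Word.Equiv.symm _ _ h, fun h k => Word.Equiv.trans _ _ _ h k⟩

/-- The horizontal tribracket with generators `G` and relations `rel`. -/
def Presented {G : Type*} (rel : Word G → Word G → Prop) : Type _ := Quotient (Word.setoid rel)

instance Presented.instHorizontalTribracket {G : Type*} (rel : Word G → Word G → Prop) :
    HorizontalTribracket (Presented rel) where
  br := Quotient.lift₂ (fun x y => Quotient.lift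
      (fun z => (Quotient.mk (Word.setoid rel) (.br x y z)))
      (fun _ _ h => Quotient.sound (.br_congr _ _ _ _ _ _ (.refl _) (.refl _) h)))
    (fun _ _ _ _ h k => by
      funext z
      induction z using Quotient.inductionOn
      exact Quotient.sound (.br_congr _ _ _ _ _ _ h k (.refl _)))
  existsUnique_right x y z := by
    induction x using Quotient.inductionOn with | _ x
    induction y using Quotient.inductionOn with | _ y
    induction z using Quotient.inductionOn with | _ z
    refine ⟨Quotient.mk _ (.rinv x y z), Quotient.sound (.br_rinv _ _ _), fun u hu => ?_⟩
    induction u using Quotient.inductionOn with | _ u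
    exact Quotient.sound (.trans _ _ _ (.symm _ _ (.rinv_br x y u))
      (.rinv_congr _ _ _ _ _ _ (.refl _) (.refl _) (Quotient.exact hu)))
  existsUnique_center x y z := by
    induction x using Quotient.inductionOn with | _ x
    induction y using Quotient.inductionOn with | _ y
    induction z using Quotient.inductionOn with | _ z
    refine ⟨Quotient.mk _ (.cinv x z y), Quotient.sound (.br_cinv _ _ _), fun u hu => ?_⟩
    induction u using Quotient.inductionOn with | _ u
    exact Quotient.sound (.trans _ _ _ (.symm _ _ (.cinv_br x u y))
      (.cinv_congr _ _ _ _ _ _ (.refl _) (Quotient.exact hu) (.refl _)))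
  existsUnique_left x y z := by
    induction x using Quotient.inductionOn with | _ x
    induction y using Quotient.inductionOn with | _ y
    induction z using Quotient.inductionOn with | _ z
    refine ⟨Quotient.mk _ (.linv z x y), Quotient.sound (.br_linv _ _ _), fun u hu => ?_⟩
    induction u using Quotient.inductionOn with | _ u
    exact Quotient.sound (.trans _ _ _ (.symm _ _ (.linv_br u x y))
      (.linv_congr _ _ _ _ _ _ (Quotient.exact hu) (.refl _) (.refl _)))
  exchange_left x y z w := by
    induction x using Quotient.inductionOn
    induction y using Quotient.inductionOn
    induction z using Quotient.inductionOn
    induction w using Quotient.inductionOn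
    exact Quotient.sound (.exchange_left _ _ _ _)
  exchange_right x y z w := by
    induction x using Quotient.inductionOn
    induction y using Quotient.inductionOn
    induction z using Quotient.inductionOn
    induction w using Quotient.inductionOn
    exact Quotient.sound (.exchange_right _ _ _ _)

end HorizontalTribracket

/-! ## Oriented link diagrams -/

/-- A signed oriented Gauss code. A *passage* `(c, s)` is one of the two strands running through
the crossing `c`: the over strand for `s = true`, the under strand for `s = false`. Following the
orientation, the strand that leaves passage `p` next enters the passage `next p`; the edge between
the two is named by the passage `p` that it leaves. `Circle` is the set of components without
crossings. -/
structure GaussCode where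
  Crossing : Type
  Circle : Type
  [finite_crossing : Finite Crossing]
  [finite_circle : Finite Circle]
  /-- `true` for positive (right-handed) crossings, `false` for negative ones. -/
  positive : Crossing → Bool
  next : Equiv.Perm (Crossing × Bool)

namespace GaussCode

attribute [instance] GaussCode.finite_crossing GaussCode.finite_circle

variable (K : GaussCode)

/-- The passages through crossings; also the edges, an edge being named by the passage it leaves. -/
abbrev Passage : Type := K.Crossing × Bool

/-- The two sides of each edge: `(e, true)` is the left side of `e`, `(e, false)` the right side. -/
abbrev Side : Type := K.Passage × Bool

/-- Draw a crossing with both strands pointing upwards. `rising c` is the passage from south-west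
to north-east (the over strand exactly if `c` is positive). -/
def rising (c : K.Crossing) : K.Passage := (c, K.positive c)

/-- The passage through `c` from south-east to north-west. -/
def falling (c : K.Crossing) : K.Passage := (c, !K.positive c)

/-- The edge that leaves a passage. -/
def outEdge (p : K.Passage) : K.Passage := p

/-- The edge that enters a passage. -/
def inEdge (p : K.Passage) : K.Passage := K.next.symm p

/-- Two edge sides that are joined at one of the four corners (west, south, east, north) of a
crossing. -/
inductive CornerRel : K.Side → K.Side → Prop
  | west (c : K.Crossing) :
      CornerRel (K.inEdge (K.rising c), true) (K.outEdge (K.falling c), true)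
  | south (c : K.Crossing) :
      CornerRel (K.inEdge (K.rising c), false) (K.inEdge (K.falling c), true)
  | east (c : K.Crossing) :
      CornerRel (K.inEdge (K.falling c), false) (K.outEdge (K.rising c), false)
  | north (c : K.Crossing) :
      CornerRel (K.outEdge (K.rising c), true) (K.outEdge (K.falling c), false)

/-- The closed boundary curves of the regions: edge sides chained together around corners, and the
two sides (`true` the left one) of each crossingless circle. -/
abbrev BoundaryCurve : Type := Quot K.CornerRel ⊕ K.Circle × Bool

/-- The number of components of the link: the cycles (fixed points included) of `next` and the
crossingless circles. -/
noncomputable def numComponents : ℕ :=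
  Nat.card (Quotient (Equiv.Perm.SameCycle.setoid K.next)) + Nat.card K.Circle

end GaussCode

/-- An oriented link diagram on the sphere (equivalently, in the plane), possibly disconnected and
possibly with crossingless components: a Gauss code together with the set of regions of the
complement and the region to which each boundary curve belongs. The regions are planar (a disc with
holes: a sphere minus as many discs as the region has boundary curves), and the surface obtained by
glueing them along the edges is a sphere: it is connected and has Euler characteristic `2`. -/
structure LinkDiagram extends GaussCode where
  Region : Type
  [finite_region : Finite Region]
  [nonempty_region : Nonempty Region]
  regionOf : toGaussCode.BoundaryCurve → Region
  /-- Any two regions are connected by a path that crosses the diagram in edges. -/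
  connected : ∀ R S : Region, Relation.EqvGen
    (fun R S =>
      (∃ e : toGaussCode.Passage,
        R = regionOf (.inl (Quot.mk _ (e, true))) ∧ S = regionOf (.inl (Quot.mk _ (e, false)))) ∨
      (∃ o : Circle, R = regionOf (.inr (o, true)) ∧ S = regionOf (.inr (o, false)))) R S
  /-- Vertices minus edges plus the Euler characteristics of the regions, a region with `b` boundary
  curves having Euler characteristic `2 - b`. (A crossingless circle contributes `0` to vertices
  minus edges.) -/
  euler : (Nat.card Crossing : ℤ) - Nat.card (Crossing × Bool)
    + (2 * Nat.card Region - Nat.card toGaussCode.BoundaryCurve) = 2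

namespace LinkDiagram

open HorizontalTribracket

attribute [instance] LinkDiagram.finite_region LinkDiagram.nonempty_region

variable (D : LinkDiagram)

/-- The region on the left (`left = true`) or right of the edge `e`. -/
def sideRegion (e : D.Passage) (left : Bool) : D.Region :=
  D.regionOf (.inl (Quot.mk _ (e, left)))

/-- The region at a crossing to the left of both strands. -/
def west (c : D.Crossing) : D.Region := D.sideRegion (D.outEdge (D.falling c)) true

/-- The region at a crossing to the right of both strands. -/
def east (c : D.Crossing) : D.Region := D.sideRegion (D.outEdge (D.rising c)) false

/-- The region at a crossing between the two outgoing edges. -/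
def north (c : D.Crossing) : D.Region := D.sideRegion (D.outEdge (D.rising c)) true

/-- The region at a crossing between the two incoming edges. -/
def south (c : D.Crossing) : D.Region := D.sideRegion (D.inEdge (D.rising c)) false

/-- The region at a crossing to the right of the over strand and to the left of the under strand. -/
def acrossOver (c : D.Crossing) : D.Region := if D.positive c then D.south c else D.north c

/-- The region at a crossing to the left of the over strand and to the right of the under strand. -/
def acrossUnder (c : D.Crossing) : D.Region := if D.positive c then D.north c else D.south c

/-- The relation at each crossing: `[x,y,z] = w`, where `x` lies to the left of both strands, `y` is
reached from `x` across the over strand, `z` is reached from `x` across the under strand, and `w`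
lies to the right of both strands. -/
inductive CrossingRel : Word D.Region → Word D.Region → Prop
  | mk (c : D.Crossing) : CrossingRel
      (.br (.gen (D.west c)) (.gen (D.acrossOver c)) (.gen (D.acrossUnder c))) (.gen (D.east c))

/-- The fundamental tribracket: a generator for each region, a relation for each crossing. -/
abbrev FundamentalTribracket : Type := Presented D.CrossingRel

/-- The tribracket counting invariant: the number of tribracket homomorphisms from the fundamental
tribracket to `X`. -/
noncomputable def countingInvariant (X : Type*) [HorizontalTribracket X] : ℕ :=
  Nat.card (Hom D.FundamentalTribracket X)

end LinkDiagram

/-! ## Homomorphisms out of a presented tribracket -/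

namespace HorizontalTribracket

section

variable {X : Type*} [HorizontalTribracket X]

/-! By the universal property, homomorphisms out of the fundamental tribracket are colourings of the
regions that satisfy the crossing relations. Late-commutativity makes the over and under strands
interchangeable in these relations, so only the planar shadow matters.

Write `transport x y` for the permutation `z ↦ [x,y,z]`. Exchange plus late-commutativity says that
the two ways of transporting around a crossing agree (`LateCommutative.transport_mul`). A colouring
thus defines a flat connection with values in `Perm X`, and on a sphere such a connection is trivial
(`exists_gauge`). Hence each region `R` carries a permutation `k R`, normalised by `k R₀ = 1`, and
an arc with colours `x` on its left and `y` on its right has the label `(k left)⁻¹ y`. The crossing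
relations say exactly that labels are constant along components.

Conversely, a label `i` acts on pairs (colour, permutation) by `step i`. These permutations commute,
so any labelling of the components is again a flat connection, and a colour at `R₀` extends
uniquely. Colourings therefore correspond to one element of `X` for `R₀` and one for each component.

Triviality of flat connections rests on the mod 2 cohomology of the sphere (`exists_potential`),
which is a dimension count from the Euler characteristic. -/

theorem br_right_injective (x y : X) : Function.Injective (br x y) := fun _ b h =>
  (existsUnique_right x y (br x y b)).unique h rfl

theorem br_left_injective (y z : X) : Function.Injective (fun x : X => br x y z) := fun _ b h =>
  (existsUnique_left y z (br b y z)).unique h rfl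

theorem Hom.ext_toFun {Y : Type*} [HorizontalTribracket Y] {φ ψ : Hom X Y}
    (h : φ.toFun = ψ.toFun) : φ = ψ := by
  cases φ
  cases ψ
  congr

/-- The value of a word under an assignment of its generators. -/
noncomputable def Word.eval {G : Type*} (f : G → X) : Word G → X
  | .gen g => f g
  | .br x y z => HorizontalTribracket.br (x.eval f) (y.eval f) (z.eval f)
  | .linv x y z => (existsUnique_left (y.eval f) (z.eval f) (x.eval f)).choose
  | .cinv x y z => (existsUnique_center (x.eval f) (z.eval f) (y.eval f)).choose
  | .rinv x y z => (existsUnique_right (x.eval f) (y.eval f) (z.eval f)).choose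

theorem Word.eval_eq_of_equiv {G : Type*} {rel : Word G → Word G → Prop} (f : G → X)
    (hf : ∀ u v, rel u v → u.eval f = v.eval f) {u v : Word G} (h : Word.Equiv rel u v) :
    u.eval f = v.eval f := by
  induction h with
  | of x y h => exact hf x y h
  | refl x => rfl
  | symm x y _ ih => exact ih.symm
  | trans x y z _ _ ih₁ ih₂ => exact ih₁.trans ih₂
  | br_congr _ _ _ _ _ _ _ _ _ ih₁ ih₂ ih₃ => simp only [Word.eval, ih₁, ih₂, ih₃]
  | linv_congr _ _ _ _ _ _ _ _ _ ih₁ ih₂ ih₃ => simp only [Word.eval, ih₁, ih₂, ih₃]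
  | cinv_congr _ _ _ _ _ _ _ _ _ ih₁ ih₂ ih₃ => simp only [Word.eval, ih₁, ih₂, ih₃]
  | rinv_congr _ _ _ _ _ _ _ _ _ ih₁ ih₂ ih₃ => simp only [Word.eval, ih₁, ih₂, ih₃]
  | br_linv x y z => exact (existsUnique_left (y.eval f) (z.eval f) (x.eval f)).choose_spec.1
  | linv_br x y z =>
    exact ((existsUnique_left (y.eval f) (z.eval f) _).choose_spec.2 (x.eval f) rfl).symm
  | br_cinv x y z => exact (existsUnique_center (x.eval f) (z.eval f) (y.eval f)).choose_spec.1
  | cinv_br x y z =>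
    exact ((existsUnique_center (x.eval f) (z.eval f) _).choose_spec.2 (y.eval f) rfl).symm
  | br_rinv x y z => exact (existsUnique_right (x.eval f) (y.eval f) (z.eval f)).choose_spec.1
  | rinv_br x y z =>
    exact ((existsUnique_right (x.eval f) (y.eval f) _).choose_spec.2 (z.eval f) rfl).symm
  | exchange_left x y z w => exact HorizontalTribracket.exchange_left _ _ _ _
  | exchange_right x y z w => exact HorizontalTribracket.exchange_right _ _ _ _

/-- The class of a word in a presented tribracket. -/
def Presented.mk {G : Type*} (rel : Word G → Word G → Prop) (u : Word G) : Presented rel :=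
  Quotient.mk (Word.setoid rel) u

/-- The definition of `Hom` asks only for compatibility with `br`; compatibility with the formal
inverses follows because they are unique solutions of equations in `br`. -/
theorem Hom.apply_mk {G : Type*} {rel : Word G → Word G → Prop} (φ : Hom (Presented rel) X)
    (u : Word G) :
    φ.toFun (Presented.mk rel u) = u.eval fun g => φ.toFun (Presented.mk rel (.gen g)) := by
  induction u with
  | gen g => rfl
  | br x y z ihx ihy ihz =>
    rw [Word.eval, ← ihx, ← ihy, ← ihz, ← φ.map_br]
    rfl
  | linv x y z ihx ihy ihz =>
    refine (existsUnique_left _ _ _).choose_spec.2 _ ?_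
    rw [← ihx, ← ihy, ← ihz]
    dsimp only
    rw [← φ.map_br]
    exact congrArg φ.toFun (Quotient.sound (.br_linv x y z))
  | cinv x y z ihx ihy ihz =>
    refine (existsUnique_center _ _ _).choose_spec.2 _ ?_
    rw [← ihx, ← ihy, ← ihz]
    dsimp only
    rw [← φ.map_br]
    exact congrArg φ.toFun (Quotient.sound (.br_cinv x y z))
  | rinv x y z ihx ihy ihz =>
    refine (existsUnique_right _ _ _).choose_spec.2 _ ?_
    rw [← ihx, ← ihy, ← ihz]
    dsimp only
    rw [← φ.map_br]
    exact congrArg φ.toFun (Quotient.sound (.br_rinv x y z))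

/-- The universal property of a presented tribracket. -/
noncomputable def Presented.homEquiv {G : Type*} (rel : Word G → Word G → Prop) :
    Hom (Presented rel) X ≃ {f : G → X // ∀ u v, rel u v → u.eval f = v.eval f} where
  toFun φ := ⟨fun g => φ.toFun (Presented.mk rel (.gen g)), fun u v h => by
    rw [← φ.apply_mk, ← φ.apply_mk]
    exact congrArg φ.toFun (Quotient.sound (.of u v h))⟩
  invFun f :=
    { toFun := Quotient.lift (Word.eval f.1) fun _ _ h => Word.eval_eq_of_equiv f.1 f.2 h
      map_br := fun x y z => by
        induction x using Quotient.inductionOn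
        induction y using Quotient.inductionOn
        induction z using Quotient.inductionOn
        rfl }
  left_inv φ := by
    refine Hom.ext_toFun (funext fun u => ?_)
    induction u using Quotient.inductionOn with | _ u
    exact (φ.apply_mk u).symm
  right_inv f := rfl

end

end HorizontalTribracket

/-! ### Reduction to region colourings of the shadow -/

namespace LinkDiagram

open HorizontalTribracket

theorem countingInvariant_eq_card_colorings (D : LinkDiagram) {X : Type*} [HorizontalTribracket X]
    (hX : LateCommutative X) :
    D.countingInvariant X = Nat.card {f : D.Region → X //
      ∀ c, br (f (D.west c)) (f (D.north c)) (f (D.south c)) = f (D.east c)} := by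
  refine Nat.card_congr ((Presented.homEquiv D.CrossingRel).trans
    (Equiv.subtypeEquivRight fun f => ?_))
  -- The sign of the crossing only swaps the last two arguments.
  have key : ∀ c, br (f (D.west c)) (f (D.acrossOver c)) (f (D.acrossUnder c)) =
      br (f (D.west c)) (f (D.north c)) (f (D.south c)) := by
    intro c
    unfold acrossOver acrossUnder
    cases D.positive c
    · rfl
    · exact hX _ _ _
  constructor
  · intro h c
    rw [← key]
    exact h _ _ (.mk c)
  · rintro h _ _ ⟨c⟩
    exact (key c).trans (h c)

end LinkDiagram

/-! ## Vanishing of the first cohomology of the sphere -/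

namespace GaussCode

variable (K : GaussCode)

/-- The sum modulo two, at each crossing, of a function on edges over the four incident half-edges. -/
def boundary : (K.Passage → ZMod 2) →ₗ[ZMod 2] (K.Crossing → ZMod 2) where
  toFun z c := ∑ s : Bool, (z (c, s) + z (K.next.symm (c, s)))
  map_add' z w := by
    funext c
    simp only [Pi.add_apply, Fintype.sum_bool]
    ring
  map_smul' a z := by
    funext c
    simp only [Pi.smul_apply, Fintype.sum_bool, smul_eq_mul, RingHom.id_apply]
    ring

/-- The sum modulo two, on each edge, of a function on crossings over the two endpoints. -/
def coboundary : (K.Crossing → ZMod 2) →ₗ[ZMod 2] (K.Passage → ZMod 2) where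
  toFun s e := s e.1 + s (K.next e).1
  map_add' s t := by
    funext c
    simp only [Pi.add_apply]
    ring
  map_smul' a z := by
    funext c
    simp only [Pi.smul_apply, smul_eq_mul, RingHom.id_apply]
    ring

theorem boundary_apply (z : K.Passage → ZMod 2) (c : K.Crossing) :
    K.boundary z c = ∑ s : Bool, (z (c, s) + z (K.next.symm (c, s))) := rfl

theorem coboundary_apply (s : K.Crossing → ZMod 2) (e : K.Passage) :
    K.coboundary s e = s e.1 + s (K.next e).1 := rfl

theorem sum_half_edges [Fintype K.Crossing] {M : Type*} [AddCommMonoid M]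
    (f : K.Passage → K.Passage → M) :
    ∑ c, ∑ s : Bool, (f (c, s) (c, s) + f (K.next.symm (c, s)) (c, s)) =
      ∑ e, (f e e + f e (K.next e)) := by
  rw [← Fintype.sum_prod_type' fun c s => f (c, s) (c, s) + f (K.next.symm (c, s)) (c, s),
    Finset.sum_add_distrib, Finset.sum_add_distrib]
  congr 1
  rw [← Equiv.sum_comp K.next]
  simp

theorem sum_boundary_mul [Fintype K.Crossing] (z : K.Passage → ZMod 2)
    (s : K.Crossing → ZMod 2) :
    ∑ c, K.boundary z c * s c = ∑ e, z e * K.coboundary s e := by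
  have := K.sum_half_edges fun e p => z e * s p.1
  simp only [boundary_apply, coboundary_apply, mul_add, Finset.sum_mul, add_mul] at this ⊢
  exact this

/-- The two maps are transposes of each other by `sum_boundary_mul`, and transposition preserves
rank. -/
theorem finrank_range_boundary :
    Module.finrank (ZMod 2) (LinearMap.range K.boundary) =
      Module.finrank (ZMod 2) (LinearMap.range K.coboundary) := by
  classical
  let _ := Fintype.ofFinite K.Crossing
  have h₁ : (LinearMap.toMatrix' K.coboundary).mulVecLin = K.coboundary := by
    rw [← Matrix.toLin'_apply', Matrix.toLin'_toMatrix']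
  have h₂ : (LinearMap.toMatrix' K.coboundary).transpose.mulVecLin = K.boundary := by
    refine LinearMap.ext fun z => funext fun c => ?_
    have := K.sum_boundary_mul z (Pi.single c 1)
    simp only [Pi.single_apply, mul_ite, mul_one, mul_zero, Finset.sum_ite_eq',
      Finset.mem_univ, if_true] at this
    rw [this, Matrix.mulVecLin_apply, Matrix.mulVec, dotProduct]
    refine Finset.sum_congr rfl fun e _ => ?_
    rw [Matrix.transpose_apply, LinearMap.toMatrix'_apply, mul_comm]
  have := Matrix.rank_transpose (LinearMap.toMatrix' K.coboundary)
  rw [Matrix.rank, Matrix.rank, h₁, h₂] at this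
  exact this

theorem finrank_ker_boundary_add :
    Module.finrank (ZMod 2) (LinearMap.ker K.boundary) + Nat.card K.Crossing =
      Module.finrank (ZMod 2) (LinearMap.ker K.coboundary) + Nat.card K.Passage := by
  classical
  let _ := Fintype.ofFinite K.Crossing
  have h₁ := LinearMap.finrank_range_add_finrank_ker K.boundary
  have h₂ := LinearMap.finrank_range_add_finrank_ker K.coboundary
  rw [Module.finrank_pi] at h₁ h₂
  rw [Nat.card_eq_fintype_card, Nat.card_eq_fintype_card]
  have := K.finrank_range_boundary
  omega

/-- A nonempty set of edges without vertices of degree one contains a cycle modulo two. -/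
theorem exists_cycle (L : Set K.Passage) (hL : L.Nonempty)
    (hdeg : ∀ (c : K.Crossing) (s : Bool), (c, s) ∈ L ∨ K.next.symm (c, s) ∈ L →
      ((c, s) ∈ L ∧ K.next.symm (c, s) ∈ L) ∨ (c, !s) ∈ L ∨ K.next.symm (c, !s) ∈ L) :
    ∃ z : K.Passage → ZMod 2, K.boundary z = 0 ∧ (∃ e, z e ≠ 0) ∧ ∀ e, z e ≠ 0 → e ∈ L := by
  classical
  let _ := Fintype.ofFinite K.Crossing
  -- The degree counts half-edges, so a loop contributes two.
  let deg : K.Crossing → ℕ := fun c =>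
    ∑ s : Bool, ((if (c, s) ∈ L then 1 else 0) + if K.next.symm (c, s) ∈ L then 1 else 0)
  let W : Set K.Crossing := {c | deg c ≠ 0}
  have hdeg_sum : ∑ c, deg c = 2 * Fintype.card L := by
    have := K.sum_half_edges fun e _ => if e ∈ L then (1 : ℕ) else 0
    refine this.trans ?_
    rw [Finset.sum_add_distrib, ← two_mul, Finset.sum_boole, Fintype.card_subtype]
    rfl
  have hdeg2 : ∀ c ∈ W, 2 ≤ deg c := by
    intro c hc
    have h₁ := hdeg c true
    have h₂ := hdeg c false
    simp only [W, deg, Set.mem_ofPred_eq, Fintype.sum_bool, Bool.not_true, Bool.not_false] at *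
    split_ifs at * <;> simp_all
  have hcard : 2 * Fintype.card W ≤ 2 * Fintype.card L := by
    rw [← hdeg_sum, mul_comm, ← smul_eq_mul, ← Finset.card_univ, ← Finset.sum_const]
    calc ∑ _c : W, 2 ≤ ∑ c : W, deg c := Finset.sum_le_sum fun c _ => hdeg2 c c.2
      _ = ∑ c ∈ W.toFinset, deg c := (Finset.sum_subtype _ (fun c => Set.mem_toFinset) deg).symm
      _ ≤ ∑ c, deg c := Finset.sum_le_sum_of_subset (Finset.subset_univ _)
  obtain ⟨e₀, he₀⟩ := hL
  have hW₀ : e₀.1 ∈ W := by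
    obtain ⟨c, s⟩ := e₀
    cases s <;> simp [W, deg, he₀]
  let ext : (L → ZMod 2) →ₗ[ZMod 2] (K.Passage → ZMod 2) :=
    { toFun := fun z e => if h : e ∈ L then z ⟨e, h⟩ else 0
      map_add' := fun z w => by
        funext e
        by_cases h : e ∈ L <;> simp [h]
      map_smul' := fun a z => by
        funext e
        by_cases h : e ∈ L <;> simp [h] }
  -- All degrees on `W` are at least two, so `W` has at most as many vertices as `L` has edges.
  -- Dropping one vertex leaves fewer equations than unknowns.
  let W' := {c : K.Crossing // c ∈ W ∧ c ≠ e₀.1}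
  let φ : (L → ZMod 2) →ₗ[ZMod 2] (W' → ZMod 2) :=
    (LinearMap.funLeft (ZMod 2) (ZMod 2) (Subtype.val : W' → K.Crossing)) ∘ₗ K.boundary ∘ₗ ext
  have hW' : Fintype.card W' < Fintype.card W := by
    refine Fintype.card_lt_of_injective_of_notMem (fun c : W' => (⟨c.1, c.2.1⟩ : W))
      (fun a b h => Subtype.ext (congrArg (fun x : W => x.1) h)) (b := ⟨e₀.1, hW₀⟩) ?_
    rintro ⟨c, hc⟩
    exact c.2.2 (congrArg Subtype.val hc)
  have hker : LinearMap.ker φ ≠ ⊥ := by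
    apply LinearMap.ker_ne_bot_of_finrank_lt
    rw [Module.finrank_pi, Module.finrank_pi]
    omega
  obtain ⟨z, hz, hz0⟩ := Submodule.exists_mem_ne_zero_of_ne_bot hker
  have hsupp : ∀ e, e ∉ L → ext z e = 0 := fun e he => by simp [ext, he]
  have hbd : ∀ c, c ≠ e₀.1 → K.boundary (ext z) c = 0 := by
    intro c hc
    by_cases hcW : c ∈ W
    · exact congrFun hz ⟨c, hcW, hc⟩
    · rw [boundary_apply]
      refine Finset.sum_eq_zero fun s _ => ?_
      simp only [W, deg, Set.mem_ofPred_eq, not_not, Finset.sum_eq_zero_iff] at hcW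
      have := hcW s (Finset.mem_univ s)
      rw [hsupp, hsupp, add_zero]
      · intro h; simp [h] at this
      · intro h; simp [h] at this
  refine ⟨ext z, ?_, ?_, fun e he => by_contra fun h => he (hsupp e h)⟩
  · funext c
    by_cases hc : c = e₀.1
    · subst hc
      -- The equation at the dropped vertex is automatic: the boundary of any chain has total sum
      -- zero.
      have := K.sum_boundary_mul (ext z) 1
      have h2 : K.coboundary 1 = 0 := by
        funext e
        exact CharTwo.add_self_eq_zero (1 : ZMod 2)
      simp only [h2, Pi.zero_apply, mul_zero, Finset.sum_const_zero, Pi.one_apply, mul_one] at this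
      rwa [Finset.sum_eq_single e₀.1 (fun c _ hc => hbd c hc)
        (fun h => absurd (Finset.mem_univ _) h)] at this
    · exact hbd c hc
  · obtain ⟨e, he⟩ := Function.ne_iff.mp hz0
    refine ⟨e.1, ?_⟩
    simpa [ext] using he

end GaussCode

/-! ### Arcs, regions and the Euler characteristic count -/

namespace LinkDiagram

variable (D : LinkDiagram)

/-- The edges together with the crossingless circles. -/
abbrev Arc : Type := D.Passage ⊕ D.Circle

/-- The region on the left (`left = true`) or right of an arc. -/
def arcSide (left : Bool) : D.Arc → D.Region
  | .inl e => D.sideRegion e left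
  | .inr o => D.regionOf (.inr (o, left))

variable {D}

theorem forall_of_arcs {P : D.Region → Prop} (R₀ : D.Region) (h₀ : P R₀)
    (h : ∀ a, P (D.arcSide true a) ↔ P (D.arcSide false a)) (R : D.Region) : P R := by
  have key : ∀ R S, P R ↔ P S := by
    intro R S
    have hRS := D.connected R S
    induction hRS with
    | rel R S hRS =>
      rcases hRS with ⟨e, rfl, rfl⟩ | ⟨o, rfl, rfl⟩
      · exact h (.inl e)
      · exact h (.inr o)
    | refl => exact Iff.rfl
    | symm _ _ _ ih => exact ih.symm
    | trans _ _ _ _ _ ih₁ ih₂ => exact ih₁.trans ih₂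
  exact (key R₀ R).mp h₀

theorem eq_of_arcs {α : Type*} {f f' : D.Region → α} (R₀ : D.Region) (h₀ : f R₀ = f' R₀)
    (h : ∀ a, f (D.arcSide true a) = f' (D.arcSide true a) ↔
      f (D.arcSide false a) = f' (D.arcSide false a)) : f = f' :=
  funext (forall_of_arcs (P := fun R => f R = f' R) R₀ h₀ h)

variable (D)

theorem sideRegion_inEdge_rising_true (c : D.Crossing) :
    D.sideRegion (D.inEdge (D.rising c)) true = D.west c :=
  congrArg (fun q => D.regionOf (.inl q)) (Quot.sound (.west c))

theorem sideRegion_inEdge_falling_true (c : D.Crossing) :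
    D.sideRegion (D.inEdge (D.falling c)) true = D.south c :=
  (congrArg (fun q => D.regionOf (.inl q)) (Quot.sound (.south c))).symm

theorem sideRegion_inEdge_falling_false (c : D.Crossing) :
    D.sideRegion (D.inEdge (D.falling c)) false = D.east c :=
  congrArg (fun q => D.regionOf (.inl q)) (Quot.sound (.east c))

theorem sideRegion_outEdge_falling_false (c : D.Crossing) :
    D.sideRegion (D.outEdge (D.falling c)) false = D.north c :=
  (congrArg (fun q => D.regionOf (.inl q)) (Quot.sound (.north c))).symm

theorem boundary_eq (z : D.Passage → ZMod 2) (c : D.Crossing) :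
    D.boundary z c = z (D.outEdge (D.rising c)) + z (D.inEdge (D.rising c)) +
      (z (D.outEdge (D.falling c)) + z (D.inEdge (D.falling c))) := by
  rw [GaussCode.boundary_apply, Fintype.sum_bool]
  unfold GaussCode.rising GaussCode.falling GaussCode.outEdge GaussCode.inEdge
  cases D.positive c
  · exact add_comm _ _
  · rfl

/-- The Euler characteristic bounds the number of connected components of the diagram. -/
theorem finrank_ker_coboundary_add_le :
    Module.finrank (ZMod 2) (LinearMap.ker D.coboundary) + Nat.card D.Circle +
      Nat.card D.Region ≤ Nat.card D.BoundaryCurve + 1 := by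
  classical
  let _ := Fintype.ofFinite D.Circle
  let _ := Fintype.ofFinite D.Region
  let _ := Fintype.ofFinite D.BoundaryCurve
  let R₀ : D.Region := Classical.arbitrary _
  have hs : ∀ (s : LinearMap.ker D.coboundary) (p : D.Passage),
      s.1 (D.inEdge p).1 = s.1 p.1 := by
    intro s p
    have := congrFun s.2 (D.inEdge p)
    rw [GaussCode.coboundary_apply, GaussCode.inEdge, Equiv.apply_symm_apply] at this
    exact CharTwo.add_eq_zero.mp this
  -- An element of the kernel is constant on connected components of the diagram, hence has a value
  -- on each boundary curve.
  let comp (s : LinearMap.ker D.coboundary) (t : D.Circle → ZMod 2) :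
      D.BoundaryCurve → ZMod 2 :=
    Sum.elim (Quot.lift (fun e => s.1 e.1.1) (by
      rintro _ _ (c | c | c | c)
      · exact hs s _
      · exact (hs s (D.rising c)).trans (hs s (D.falling c)).symm
      · exact hs s _
      · rfl)) (fun o => t o.1)
  -- Consider the bipartite graph whose vertices are diagram components and regions and whose edges
  -- are boundary curves. It is connected, so a function with zero coboundary that vanishes at `R₀`
  -- is zero; the extra coordinate records the value at `R₀`.
  let φ : (LinearMap.ker D.coboundary × (D.Circle → ZMod 2) × (D.Region → ZMod 2)) →ₗ[ZMod 2]
      (D.BoundaryCurve → ZMod 2) × ZMod 2 :=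
    { toFun := fun x => (fun β => comp x.1 x.2.1 β + x.2.2 (D.regionOf β), x.2.2 R₀)
      map_add' := fun x y => by
        refine Prod.ext (funext fun β => ?_) rfl
        rcases β with ⟨⟨e⟩⟩ | o
        · exact add_add_add_comm _ _ _ _
        · exact add_add_add_comm _ _ _ _
      map_smul' := fun a x => by
        refine Prod.ext (funext fun β => ?_) rfl
        rcases β with ⟨⟨e⟩⟩ | o
        · exact (mul_add _ _ _).symm
        · exact (mul_add _ _ _).symm }
  have hφ : Function.Injective φ := by
    rw [injective_iff_map_eq_zero]
    rintro ⟨s, t, r⟩ h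
    have hβ : ∀ β, comp s t β = r (D.regionOf β) := fun β =>
      CharTwo.add_eq_zero.mp (congrFun (congrArg Prod.fst h) β)
    have hr : r = 0 := by
      refine eq_of_arcs R₀ (congrArg Prod.snd h) ?_
      have : ∀ a, r (D.arcSide true a) = r (D.arcSide false a) := by
        rintro (e | o)
        · exact (hβ (.inl (Quot.mk _ (e, true)))).symm.trans (hβ (.inl (Quot.mk _ (e, false))))
        · exact (hβ (.inr (o, true))).symm.trans (hβ (.inr (o, false)))
      intro a
      rw [this a]
      rfl
    subst hr
    refine Prod.ext (Subtype.ext (funext fun c => ?_)) (Prod.ext (funext fun o => ?_) rfl)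
    · exact hβ (.inl (Quot.mk _ ((c, true), true)))
    · exact hβ (.inr (o, true))
  have := LinearMap.finrank_le_finrank_of_injective hφ
  simp only [Module.finrank_prod, Module.finrank_pi, Module.finrank_self] at this
  simp only [Nat.card_eq_fintype_card] at this ⊢
  omega

/-- A cocycle modulo two is a coboundary. -/
theorem exists_potential (z : D.Arc → ZMod 2) (hz : D.boundary (fun e => z (.inl e)) = 0) :
    ∃ r : D.Region → ZMod 2, ∀ a, z a = r (D.arcSide true a) + r (D.arcSide false a) := by
  classical
  let _ := Fintype.ofFinite D.Circle
  let _ := Fintype.ofFinite D.Region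
  let _ := Fintype.ofFinite D.Crossing
  let R₀ : D.Region := Classical.arbitrary _
  -- The image consists of cycles because each of the four corner regions occurs twice in the sum at
  -- a crossing.
  let δ : (D.Region → ZMod 2) →ₗ[ZMod 2] LinearMap.ker D.boundary × (D.Circle → ZMod 2) :=
    { toFun := fun r =>
        (⟨fun e => r (D.sideRegion e true) + r (D.sideRegion e false), by
          rw [LinearMap.mem_ker]
          funext c
          rw [boundary_eq, sideRegion_inEdge_rising_true, sideRegion_inEdge_falling_true,
            sideRegion_inEdge_falling_false, sideRegion_outEdge_falling_false]
          change r (D.north c) + r (D.east c) + (r (D.west c) + r (D.south c)) +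
            (r (D.west c) + r (D.north c) + (r (D.south c) + r (D.east c))) = 0
          generalize r (D.north c) = n
          generalize r (D.east c) = e
          generalize r (D.west c) = w
          generalize r (D.south c) = s
          revert n e w s
          decide⟩,
        fun o => r (D.regionOf (.inr (o, true))) + r (D.regionOf (.inr (o, false))))
      map_add' := fun x y => Prod.ext
        (Subtype.ext (funext fun _ => add_add_add_comm _ _ _ _))
        (funext fun _ => add_add_add_comm _ _ _ _)
      map_smul' := fun a x => Prod.ext
        (Subtype.ext (funext fun _ => (mul_add _ _ _).symm))
        (funext fun _ => (mul_add _ _ _).symm) }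
  have hinj : Function.Injective
      ((LinearMap.proj R₀ : (D.Region → ZMod 2) →ₗ[ZMod 2] ZMod 2).domRestrict
        (LinearMap.ker δ)) := by
    rw [injective_iff_map_eq_zero]
    rintro ⟨r, hδ⟩ h
    rw [LinearMap.mem_ker] at hδ
    refine Subtype.ext (eq_of_arcs R₀ h ?_)
    have : ∀ a, r (D.arcSide true a) = r (D.arcSide false a) := by
      rintro (e | o)
      · exact CharTwo.add_eq_zero.mp (congrFun (congrArg Subtype.val (congrArg Prod.fst hδ)) e)
      · exact CharTwo.add_eq_zero.mp (congrFun (congrArg Prod.snd hδ) o)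
    intro a
    change r _ = 0 ↔ r _ = 0
    rw [this a]
  have h₀ := LinearMap.finrank_le_finrank_of_injective hinj
  have h₁ := LinearMap.finrank_range_add_finrank_ker δ
  rw [Module.finrank_self] at h₀
  rw [Module.finrank_pi, ← Nat.card_eq_fintype_card] at h₁
  have h₂ := D.finrank_ker_coboundary_add_le
  have h₃ := D.finrank_ker_boundary_add
  have h₄ : (Nat.card D.Crossing : ℤ) - Nat.card D.Passage
    + (2 * Nat.card D.Region - Nat.card D.BoundaryCurve) = 2 := D.euler
  -- The kernel of `δ` has dimension at most one, so its rank is at least the number of regions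
  -- minus one. By `h₂`, `h₃` and Euler's formula `h₄`, the target has at most that dimension.
  have hrange : LinearMap.range δ = ⊤ := by
    apply Submodule.eq_top_of_finrank_eq
    apply le_antisymm (Submodule.finrank_le _)
    rw [Module.finrank_prod, Module.finrank_pi, ← Nat.card_eq_fintype_card]
    omega
  obtain ⟨r, hr⟩ := LinearMap.range_eq_top.mp hrange
    (⟨fun e => z (.inl e), hz⟩, fun o => z (.inr o))
  refine ⟨r, ?_⟩
  rintro (e | o)
  · exact (congrFun (congrArg Subtype.val (congrArg Prod.fst hr)) e).symm
  · exact (congrFun (congrArg Prod.snd hr) o).symm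

/-- A flat connection on the sphere is trivial. -/
theorem exists_gauge {G : Type*} [Group G] (g : D.Arc → G)
    (hg : ∀ c, g (.inl (D.outEdge (D.rising c))) * g (.inl (D.outEdge (D.falling c))) =
      g (.inl (D.inEdge (D.falling c))) * g (.inl (D.inEdge (D.rising c)))) :
    ∃ h : D.Region → G, ∀ a, h (D.arcSide false a) = g a * h (D.arcSide true a) := by
  classical
  let good (h : D.Region → G) : Set D.Arc :=
    {a | h (D.arcSide false a) = g a * h (D.arcSide true a)}
  -- A maximal set of good arcs plays the role of a spanning tree of the dual graph.
  obtain ⟨_, ⟨h, rfl⟩, hmax⟩ :=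
    (Set.toFinite (Set.range good)).exists_maximal (Set.range_nonempty good)
  have hmax' : ∀ h', good h ⊆ good h' → good h' ⊆ good h := fun h' => hmax ⟨h', rfl⟩
  -- Good arcs connect all regions: otherwise right multiplication of `h` by a constant on one class
  -- of `r` keeps every good arc and makes a further arc good.
  have hconn : ∀ r : D.Region → ZMod 2,
      (∀ a ∈ good h, r (D.arcSide true a) = r (D.arcSide false a)) →
      ∀ a, r (D.arcSide true a) = r (D.arcSide false a) := by
    intro r hr a
    by_contra hne
    let k : G := (h (D.arcSide true a))⁻¹ * (g a)⁻¹ * h (D.arcSide false a)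
    let h' : D.Region → G := fun R =>
      if r R = r (D.arcSide true a) then h R * k else h R
    have hsub : good h ⊆ good h' := by
      intro b hb
      have hb' : h (D.arcSide false b) = g b * h (D.arcSide true b) := hb
      change h' (D.arcSide false b) = g b * h' (D.arcSide true b)
      simp only [h', hr b hb, hb']
      split_ifs
      · group
      · rfl
    have ha : a ∈ good h' := by
      change h' (D.arcSide false a) = g a * h' (D.arcSide true a)
      simp only [h', k, if_neg (Ne.symm hne), if_true]
      group
    exact hne (hr a (hmax' h' hsub ha))
  have hcocycle : ∀ z : D.Arc → ZMod 2, D.boundary (fun e => z (.inl e)) = 0 →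
      (∀ a ∈ good h, z a = 0) → z = 0 := by
    intro z hz hz0
    obtain ⟨r, hr⟩ := D.exists_potential z hz
    funext a
    rw [hr a]
    refine CharTwo.add_eq_zero.mpr (hconn r (fun b hb => ?_) a)
    exact CharTwo.add_eq_zero.mp ((hr b).symm.trans (hz0 b hb))
  have hedge : ∀ e : D.Passage, (.inl e : D.Arc) ∈ good h := by
    -- By flatness, three good edges at a crossing force the fourth to be good. The bad edges thus
    -- have no vertex of degree one, and a mod 2 cycle among them would be a nonzero cocycle
    -- vanishing on good arcs.
    by_contra! hbad
    obtain ⟨z, hz, ⟨e, he⟩, hzL⟩ := D.exists_cycle {e | (.inl e : D.Arc) ∉ good h} hbad (by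
      intro c s hs
      have hflat := hg c
      have h₁ : (.inl (D.outEdge (D.falling c)) : D.Arc) ∈ good h →
          (.inl (D.inEdge (D.falling c)) : D.Arc) ∈ good h →
          ((.inl (D.outEdge (D.rising c)) : D.Arc) ∈ good h ↔
            (.inl (D.inEdge (D.rising c)) : D.Arc) ∈ good h) := by
        simp only [good, Set.mem_ofPred_eq, arcSide, sideRegion_inEdge_rising_true,
          sideRegion_inEdge_falling_true, sideRegion_inEdge_falling_false,
          sideRegion_outEdge_falling_false]
        change h (D.north c) = _ * h (D.west c) → h (D.east c) = _ →
          (h (D.east c) = _ * h (D.north c) ↔ h (D.south c) = _)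
        intro h₂ h₃
        rw [h₂, h₃, ← mul_assoc, hflat, mul_assoc, mul_right_inj]
      have h₂ : (.inl (D.outEdge (D.rising c)) : D.Arc) ∈ good h →
          (.inl (D.inEdge (D.rising c)) : D.Arc) ∈ good h →
          ((.inl (D.outEdge (D.falling c)) : D.Arc) ∈ good h ↔
            (.inl (D.inEdge (D.falling c)) : D.Arc) ∈ good h) := by
        simp only [good, Set.mem_ofPred_eq, arcSide, sideRegion_inEdge_rising_true,
          sideRegion_inEdge_falling_true, sideRegion_inEdge_falling_false,
          sideRegion_outEdge_falling_false]
        change h (D.east c) = _ * h (D.north c) → h (D.south c) = _ →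
          (h (D.north c) = _ * h (D.west c) ↔ h (D.east c) = _)
        intro h₁ h₄
        rw [h₁, h₄, ← mul_assoc, ← hflat, mul_assoc, mul_right_inj]
      unfold GaussCode.rising GaussCode.falling GaussCode.outEdge GaussCode.inEdge at h₁ h₂
      simp only [Set.mem_ofPred_eq] at hs ⊢
      by_cases hc : D.positive c = s
      · rw [hc] at h₁ h₂
        tauto
      · obtain rfl : s = !D.positive c := Bool.eq_not_of_ne (Ne.symm hc)
        rw [Bool.not_not]
        tauto)
    have := hcocycle (Sum.elim z 0) hz (by
      rintro (e | o) ha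
      · by_contra h0
        exact hzL e h0 ha
      · rfl)
    exact he (congrFun this (.inl e))
  refine ⟨h, ?_⟩
  rintro (e | o)
  · exact hedge e
  · by_contra ho
    -- A circle meets no crossing, so its indicator function is a cocycle.
    have := hcocycle (Pi.single (.inr o) 1) (by
      funext c
      simp [GaussCode.boundary_apply]) (by
      intro a ha
      refine Pi.single_eq_of_ne ?_ _
      rintro rfl
      exact ho ha)
    simpa using congrFun this (.inr o)

end LinkDiagram

/-! ## Late-commutative tribrackets -/

namespace HorizontalTribracket

variable {X : Type*} [HorizontalTribracket X] [Finite X]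

/-- The permutation `z ↦ [x,y,z]`. -/
noncomputable def transport (x y : X) : Equiv.Perm X :=
  Equiv.ofBijective (br x y) (Finite.injective_iff_bijective.mp (br_right_injective x y))

theorem transport_apply (x y z : X) : transport x y z = br x y z := rfl

/-- This is the flatness that drives the proof: exchange compares the two routes from `x` across two
strands, and late-commutativity identifies their final colours. -/
theorem LateCommutative.transport_mul (hX : LateCommutative X) (x y z : X) :
    transport y (br x y z) * transport x y = transport z (br x z y) * transport x z := by
  ext w
  simp only [Equiv.Perm.mul_apply, transport_apply]
  rw [exchange_left, hX x y z]

/-- On pairs of an element and a labelling, replace the element by the one labelled `i` and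
transport the labels along. -/
noncomputable def step (i : X) : Equiv.Perm (X × Equiv.Perm X) :=
  Equiv.ofBijective (fun s => (s.2 i, transport s.1 (s.2 i) * s.2))
    (Finite.injective_iff_bijective.mp (by
      rintro ⟨x, h⟩ ⟨y, k⟩ hxy
      obtain ⟨h₁, h₂⟩ := Prod.mk.inj hxy
      dsimp only at h₁ h₂
      obtain rfl : x = y := by
        -- The new permutation sends `i` to `[x, k i, k i]`, from which `x` is recovered by left
        -- invertibility.
        refine br_left_injective (k i) (k i) ?_
        have := congrArg (fun p : Equiv.Perm X => p i) h₂
        simpa only [h₁, Equiv.Perm.mul_apply, transport_apply] using this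
      rw [h₁] at h₂
      rw [mul_left_cancel h₂]))

theorem step_apply (i : X) (s : X × Equiv.Perm X) :
    step i s = (s.2 i, transport s.1 (s.2 i) * s.2) := rfl

theorem LateCommutative.step_mul_comm (hX : LateCommutative X) (i j : X) :
    step i * step j = step j * step i := by
  ext1 s
  simp only [Equiv.Perm.mul_apply, step_apply, transport_apply]
  rw [← mul_assoc, ← mul_assoc, hX.transport_mul, hX]

end HorizontalTribracket

/-! ## Colourings and labels of components -/

namespace GaussCode

variable (K : GaussCode)

/-- The components of the link. -/
abbrev Component : Type := Quotient (Equiv.Perm.SameCycle.setoid K.next) ⊕ K.Circle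

variable {K}

theorem eq_of_sameCycle {α : Type*} {f : K.Passage → α}
    (hf : ∀ p, f (K.inEdge p) = f p) {p q : K.Passage} (h : K.next.SameCycle p q) : f p = f q := by
  have hf' : ∀ p, f (K.next p) = f p := fun p => by
    rw [← hf, inEdge, Equiv.symm_apply_apply]
  obtain ⟨i, rfl⟩ := h
  induction i with
  | zero => rfl
  | succ i ih => rw [add_comm, zpow_one_add, Equiv.Perm.mul_apply, hf', ih]
  | pred i ih =>
    rw [sub_eq_neg_add, zpow_add, zpow_neg_one, Equiv.Perm.mul_apply, ih]
    exact (hf _).symm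

end GaussCode

namespace LinkDiagram

open HorizontalTribracket

variable (D : LinkDiagram)

/-- The component to which an arc belongs. -/
def arcComponent : D.Arc → D.Component := Sum.map (Quotient.mk _) id

theorem arcComponent_inEdge (p : D.Passage) :
    D.arcComponent (.inl (D.inEdge p)) = D.arcComponent (.inl p) :=
  congrArg Sum.inl (Quotient.sound ⟨1, by simp [GaussCode.inEdge]⟩)

theorem arcComponent_surjective : Function.Surjective D.arcComponent :=
  Sum.map_surjective.mpr ⟨Quotient.mk_surjective, Function.surjective_id⟩

theorem card_component : Nat.card D.Component = D.numComponents := by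
  rw [Nat.card_sum]
  rfl

variable {D} {X : Type*} [HorizontalTribracket X] [Finite X]

/-- The connection depends only on component labels, so flatness at a crossing is commutation of two
steps. The gauge gives permutations of the set of states; applying them to a single state gives the
family. -/
theorem exists_states (hX : LateCommutative X) (R₀ : D.Region) (x : X) (l : D.Component → X) :
    ∃ st : D.Region → X × Equiv.Perm X, st R₀ = (x, 1) ∧
      ∀ a, st (D.arcSide false a) = step (l (D.arcComponent a)) (st (D.arcSide true a)) := by
  obtain ⟨h, hh⟩ := D.exists_gauge (fun a => step (l (D.arcComponent a))) (fun c => by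
    simp only [arcComponent_inEdge]
    exact hX.step_mul_comm _ _)
  refine ⟨fun R => h R ((h R₀)⁻¹ (x, 1)), ?_, fun a => ?_⟩
  · exact Equiv.apply_symm_apply _ _
  · dsimp only
    rw [hh]
    rfl

/-- The colours given by a family of states satisfy the crossing relations. -/
theorem br_of_states {st : D.Region → X × Equiv.Perm X} {l : D.Component → X}
    (hst : ∀ a, st (D.arcSide false a) = step (l (D.arcComponent a)) (st (D.arcSide true a)))
    (c : D.Crossing) :
    br (st (D.west c)).1 (st (D.north c)).1 (st (D.south c)).1 = (st (D.east c)).1 := by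
  have hN := hst (.inl (D.outEdge (D.falling c)))
  have hE := hst (.inl (D.outEdge (D.rising c)))
  have hS := hst (.inl (D.inEdge (D.rising c)))
  rw [arcComponent_inEdge] at hS
  simp only [arcSide, sideRegion_inEdge_rising_true, sideRegion_outEdge_falling_false] at hN hE hS
  change st (D.north c) = step _ (st (D.west c)) at hN
  change st (D.east c) = step _ (st (D.north c)) at hE
  change st (D.south c) = step _ (st (D.west c)) at hS
  rw [hE, hN, hS]
  rfl

/-- The colours of a family of states determine the labels of the components. -/
theorem labels_unique {R₀ : D.Region} {st st' : D.Region → X × Equiv.Perm X}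
    {l l' : D.Component → X}
    (hst : ∀ a, st (D.arcSide false a) = step (l (D.arcComponent a)) (st (D.arcSide true a)))
    (hst' : ∀ a, st' (D.arcSide false a) = step (l' (D.arcComponent a)) (st' (D.arcSide true a)))
    (h₀ : (st R₀).2 = (st' R₀).2) (h : ∀ R, (st R).1 = (st' R).1) : l = l' := by
  -- The permutations are propagated by transports that depend on the colours alone.
  have h₂ : (fun R => (st R).2) = fun R => (st' R).2 := by
    refine eq_of_arcs R₀ h₀ fun a => ?_
    have e₁ := congrArg Prod.fst (hst a)
    have e₂ := congrArg Prod.snd (hst a)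
    have e₁' := congrArg Prod.fst (hst' a)
    have e₂' := congrArg Prod.snd (hst' a)
    simp only [step_apply] at e₁ e₂ e₁' e₂'
    rw [e₂, e₂', ← e₁, ← e₁', h, h, mul_right_inj]
  funext k
  obtain ⟨a, rfl⟩ := D.arcComponent_surjective k
  have e₁ := congrArg Prod.fst (hst a)
  have e₁' := congrArg Prod.fst (hst' a)
  simp only [step_apply] at e₁ e₁'
  rw [h, e₁', ← congrFun h₂ (D.arcSide true a)] at e₁
  exact ((Equiv.injective _) e₁).symm

/-- A family of states is determined by one of its members and the labels of the components. -/
theorem states_unique {R₀ : D.Region} {st st' : D.Region → X × Equiv.Perm X}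
    {l : D.Component → X}
    (hst : ∀ a, st (D.arcSide false a) = step (l (D.arcComponent a)) (st (D.arcSide true a)))
    (hst' : ∀ a, st' (D.arcSide false a) = step (l (D.arcComponent a)) (st' (D.arcSide true a)))
    (h₀ : st R₀ = st' R₀) : st = st' :=
  eq_of_arcs R₀ h₀ fun a => by rw [hst, hst', Equiv.apply_eq_iff_eq]

/-- Every colouring comes from a family of states. -/
theorem exists_states_of_coloring (hX : LateCommutative X) (R₀ : D.Region) (f : D.Region → X)
    (hf : ∀ c, br (f (D.west c)) (f (D.north c)) (f (D.south c)) = f (D.east c)) :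
    ∃ (k : D.Region → Equiv.Perm X) (l : D.Component → X), k R₀ = 1 ∧
      ∀ a, (f (D.arcSide false a), k (D.arcSide false a)) =
        step (l (D.arcComponent a)) (f (D.arcSide true a), k (D.arcSide true a)) := by
  obtain ⟨h, hh⟩ := D.exists_gauge
    (fun a => transport (f (D.arcSide true a)) (f (D.arcSide false a))) (fun c => by
      simp only [arcSide, sideRegion_inEdge_rising_true, sideRegion_inEdge_falling_true,
          sideRegion_inEdge_falling_false, sideRegion_outEdge_falling_false]
      change transport (f (D.north c)) (f (D.east c)) * transport (f (D.west c)) (f (D.north c)) =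
        transport (f (D.south c)) (f (D.east c)) * transport (f (D.west c)) (f (D.south c))
      rw [← hf, hX.transport_mul, hX])
  -- Right multiplication by a constant preserves the gauge equation.
  let k : D.Region → Equiv.Perm X := fun R => h R * (h R₀)⁻¹
  have hk : ∀ a, k (D.arcSide false a) =
      transport (f (D.arcSide true a)) (f (D.arcSide false a)) * k (D.arcSide true a) :=
    fun a => by simp only [k, hh, mul_assoc]
  let lab : D.Arc → X := fun a => (k (D.arcSide true a)).symm (f (D.arcSide false a))
  have hlab : ∀ a, k (D.arcSide true a) (lab a) = f (D.arcSide false a) :=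
    fun a => Equiv.apply_symm_apply _ _
  -- Pulled back to the west region, the crossing relation says that the label of a strand is the
  -- same before and after it crosses the other one.
  have hin : ∀ p, lab (.inl (D.inEdge p)) = lab (.inl p) := by
    rintro ⟨c, s⟩
    have hNk := hk (.inl (D.outEdge (D.falling c)))
    have hSk := hk (.inl (D.inEdge (D.rising c)))
    have h₁ := hlab (.inl (D.outEdge (D.falling c)))
    have h₂ := hlab (.inl (D.outEdge (D.rising c)))
    have h₃ := hlab (.inl (D.inEdge (D.rising c)))
    have h₄ := hlab (.inl (D.inEdge (D.falling c)))
    simp only [arcSide, sideRegion_inEdge_rising_true, sideRegion_inEdge_falling_true,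
      sideRegion_inEdge_falling_false, sideRegion_outEdge_falling_false] at hNk hSk h₁ h₂ h₃ h₄
    change k (D.north c) = transport (f (D.west c)) _ * k (D.west c) at hNk
    change k (D.south c) = transport _ (f (D.south c)) * _ at hSk
    change k (D.west c) _ = _ at h₁
    change k (D.north c) _ = f (D.east c) at h₂
    change k (D.west c) _ = f (D.south c) at h₃
    have hR : lab (.inl (D.inEdge (D.rising c))) = lab (.inl (D.outEdge (D.rising c))) := by
      apply (k (D.north c)).injective
      rw [h₂, hNk, Equiv.Perm.mul_apply, h₃, transport_apply, hf]
    have hF : lab (.inl (D.inEdge (D.falling c))) = lab (.inl (D.outEdge (D.falling c))) := by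
      apply (k (D.south c)).injective
      rw [h₄, hSk, Equiv.Perm.mul_apply, h₁, transport_apply, hX, hf]
    by_cases hc : D.positive c = s
    · rw [← hc]
      exact hR
    · obtain rfl : s = !D.positive c := Bool.eq_not_of_ne (Ne.symm hc)
      exact hF
  refine ⟨k, Sum.elim (Quotient.lift (fun p => lab (.inl p))
    fun _ _ h => GaussCode.eq_of_sameCycle (f := fun p => lab (.inl p)) hin h)
    (fun o => lab (.inr o)), mul_inv_cancel _, fun a => ?_⟩
  have hcomp : Sum.elim (Quotient.lift (fun p => lab (.inl p))
      fun _ _ h => GaussCode.eq_of_sameCycle (f := fun p => lab (.inl p)) hin h)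
      (fun o => lab (.inr o)) (D.arcComponent a) = lab a := by
    rcases a with e | o <;> rfl
  rw [hcomp, step_apply]
  dsimp only
  rw [hlab, hk]

theorem card_colorings (hX : LateCommutative X) (D : LinkDiagram) :
    Nat.card {f : D.Region → X //
      ∀ c, br (f (D.west c)) (f (D.north c)) (f (D.south c)) = f (D.east c)} =
    Nat.card X ^ (D.numComponents + 1) := by
  let R₀ : D.Region := Classical.arbitrary _
  choose st hst₀ hst using exists_states (D := D) hX R₀
  have hbij : Function.Bijective (fun xl : X × (D.Component → X) =>
      (⟨fun R => (st xl.1 xl.2 R).1, br_of_states (hst xl.1 xl.2)⟩ : {f : D.Region → X //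
        ∀ c, br (f (D.west c)) (f (D.north c)) (f (D.south c)) = f (D.east c)})) := by
    constructor
    · rintro ⟨x, l⟩ ⟨y, m⟩ h
      have h' : ∀ R, (st x l R).1 = (st y m R).1 := congrFun (congrArg Subtype.val h)
      have h₀ := h' R₀
      rw [hst₀, hst₀] at h₀
      refine Prod.ext h₀ (labels_unique (R₀ := R₀) (hst x l) (hst y m) ?_ h')
      rw [hst₀, hst₀]
    · rintro ⟨f, hf⟩
      -- The states built from `f` and those chosen for `(f R₀, l)` agree at `R₀`, hence everywhere.
      obtain ⟨k, l, hk, hkl⟩ := exists_states_of_coloring hX R₀ f hf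
      refine ⟨(f R₀, l), Subtype.ext (funext fun R => ?_)⟩
      have := states_unique (R₀ := R₀) (st' := fun R => (f R, k R)) (hst (f R₀) l) hkl
        (by rw [hst₀, hk])
      exact congrArg Prod.fst (congrFun this R)
  rw [← Nat.card_congr (Equiv.ofBijective _ hbij), Nat.card_prod, Nat.card_fun, card_component,
    pow_succ']

end LinkDiagram

theorem mainTheorem2 {X : Type*} [HorizontalTribracket X] [Finite X]
    (hX : HorizontalTribracket.LateCommutative X) (D : LinkDiagram) :
    D.countingInvariant X = Nat.card X ^ (D.numComponents + 1) := by
  rw [D.countingInvariant_eq_card_colorings hX, LinkDiagram.card_colorings hX]
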